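/- Let $\mathcal T\subset\mathbb{R}^3$ be a (nondegenerate, closed) tetrahedron and let $\mathcal C$ be a finite oriented geometric simplicial complex of dimension at most $2$ in $\mathbb{R}^3$ (so the intersection of two cells is empty or a common face, and each edge and each triangle carries an orientation) such that $|\mathcal C|$, the union of the cells of $\mathcal C$, lies in the interior of $\mathcal T$. For a triangle $\delta=[abc]$ of $\mathcal C$ let $n_\delta$ be the unit vector in the direction $\vec{ab}\times\vec{bc}$. Let $v_+(\delta)$ and $v_-(\delta)$ be the points obtained from the centroid of $\delta$ by moving the distance $\varepsilon_\delta>0$ in the directions $n_\delta$ and $-n_\delta$. Here $\varepsilon_\delta$ is so small that the segment $[v_-(\delta),v_+(\delta)]$ lies in $\mathcal T$ and meets no cell of $\mathcal C$ other than $\delta$. If $\delta'$ is $\delta$ with the opposite orientation, then $v_\pm(\delta')=v_\mp(\delta)$. The triangle adjacency graph $tag(\mathcal C)$ has as vertices all the symbols $v_+(\delta),v_-(\delta)$, for $\delta$ a triangle of $\mathcal C$. Its undirected edges are the following. For each edge $e$ of $\mathcal C$ at which at least one triangle is incident, orient the triangles incident at $e$ so as to agree with $e$, and let $\delta_1,\dots,\delta_k,\delta_1$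 be the order in which they are met when one rotates about $e$ in the direction consistent with its orientation (right-hand rule). Then $tag(\mathcal C)$ has the edges $$(v_+(\delta_1),v_-(\delta_2)),\ \dots,\ (v_+(\delta_{k-1}),v_-(\delta_k)),\ (v_+(\delta_k),v_-(\delta_1)),$$ which for $k=1$ is the single edge $(v_+(\delta_1),v_-(\delta_1))$. Let $\delta_1,\delta_2$ be triangles of $\mathcal C$ and let $s_1,s_2\in\{+,-\}$. If the vertices $v_{s_1}(\delta_1)$ and $v_{s_2}(\delta_2)$ are joined by a path in $tag(\mathcal C)$, then the points $v_{s_1}(\delta_1)$ and $v_{s_2}(\delta_2)$ of $\mathbb{R}^3$ are joined by a continuous path in $\mathcal T\setminus|\mathcal C|$. -/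

import Mathlib

noncomputable section

/-- Euclidean three-dimensional space. -/
abbrev E3 : Type := EuclideanSpace ℝ (Fin 3)

/-- The (right-handed) vector cross product on `E3`. -/
def cross (x y : E3) : E3 := WithLp.toLp 2 (crossProduct x.ofLp y.ofLp)

/-- A finite oriented 2-complex embedded in `E3`: a finite geometric simplicial complex all of
whose cells have dimension at most two, in which every 1-cell and every 2-cell carries an
orientation, given by an ordering of its vertices. (For a 2-cell, orderings which differ by an even
permutation represent the same orientation; everything below depends only on the orientation.) -/
structure OrientedTwoComplex where
  /-- the underlying simplicial complex, its cells being given by their sets of vertices -/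
  cx : Geometry.SimplicialComplex ℝ E3
  finite_faces : cx.faces.Finite
  card_le_three : ∀ s ∈ cx.faces, s.card ≤ 3
  /-- the ordering of the two ends of a 1-cell -/
  edgeVert : {s : Finset E3 // s ∈ cx.faces ∧ s.card = 2} → Fin 2 → E3
  range_edgeVert : ∀ e, Set.range (edgeVert e) = (e.1 : Set E3)
  /-- the ordering of the three vertices of a 2-cell -/
  triVert : {s : Finset E3 // s ∈ cx.faces ∧ s.card = 3} → Fin 3 → E3
  range_triVert : ∀ δ, Set.range (triVert δ) = (δ.1 : Set E3)

namespace OrientedTwoComplex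

variable (C : OrientedTwoComplex)

/-- The 1-cells (edges) of the complex. -/
abbrev Edge : Type := {s : Finset E3 // s ∈ C.cx.faces ∧ s.card = 2}

/-- The 2-cells (triangles) of the complex. -/
abbrev Triangle : Type := {s : Finset E3 // s ∈ C.cx.faces ∧ s.card = 3}

/-- The unit normal of the triangle oriented as `[abc]`, in the direction of `ab × bc`. -/
def unitNormal (δ : C.Triangle) : E3 :=
  let n := cross (C.triVert δ 1 - C.triVert δ 0) (C.triVert δ 2 - C.triVert δ 1)
  ‖n‖⁻¹ • n

/-- The centroid of a triangle. -/
def centroid (δ : C.Triangle) : E3 := (3 : ℝ)⁻¹ • ∑ i, C.triVert δ i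

/-- The vertices of the triangle adjacency graph: `(δ, 1)` is `v₊(δ)` and `(δ, -1)` is `v₋(δ)`. -/
abbrev TagVertex : Type := C.Triangle × ℤˣ

/-- The point of space that belongs to a vertex `v_±(δ)`: it lies at distance `ε δ` from the
centroid of `δ`, in the direction of the unit normal for `v₊` and opposite to it for `v₋`. -/
def point (ε : C.Triangle → ℝ) (v : C.TagVertex) : E3 :=
  C.centroid v.1 + (((v.2 : ℤ) : ℝ) * ε v.1) • C.unitNormal v.1

/-- The offsets `ε` are small enough, relative to a region `T`: they are positive, and for each
triangle `δ` the segment from `v₋(δ)` to `v₊(δ)` lies in `T` and meets no other cell of the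
complex. -/
def AdmissibleOffset (T : Set E3) (ε : C.Triangle → ℝ) : Prop :=
  ∀ δ : C.Triangle, 0 < ε δ ∧
    segment ℝ (C.point ε (δ, -1)) (C.point ε (δ, 1)) ⊆ T ∧
    ∀ s ∈ C.cx.faces, s ≠ δ.1 →
      Disjoint (segment ℝ (C.point ε (δ, -1)) (C.point ε (δ, 1))) (convexHull ℝ (s : Set E3))

/-- The triangle `δ` is incident at the edge `e`. -/
def Incident (e : C.Edge) (δ : C.Triangle) : Prop := e.1 ⊆ δ.1

open Classical in
/-- For a triangle `δ` incident at the edge `e`: `1` if the orientation of `δ` agrees with that of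
`e`, i.e. `e` occurs with a positive sign in the boundary of `δ`, and `-1` otherwise. -/
def incidenceSign (e : C.Edge) (δ : C.Triangle) : ℤˣ :=
  if ∃ i : Fin 3, C.triVert δ i = C.edgeVert e 0 ∧ C.triVert δ (i + 1) = C.edgeVert e 1
  then 1 else -1

/-- The rotation by the angle `θ` about the line through the edge `e`, in the direction consistent
with the orientation of `e` (right-hand rule). -/
def rotateAbout (e : C.Edge) (θ : ℝ) (x : E3) : E3 :=
  let a := C.edgeVert e 0
  let u := ‖C.edgeVert e 1 - a‖⁻¹ • (C.edgeVert e 1 - a)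
  a + (Real.cos θ • (x - a) + Real.sin θ • cross u (x - a)
    + ((1 - Real.cos θ) * inner ℝ u (x - a)) • u)

/-- The open half-plane which is bounded by the line through the edge `e` and contains the
interior of the triangle `δ` (for `δ` incident at `e`; `c` is the vertex of `δ` opposite to
`e`). -/
def halfPlane (e : C.Edge) (δ : C.Triangle) : Set E3 :=
  {x | ∃ c ∈ δ.1, c ∉ e.1 ∧ ∃ s t : ℝ, 0 < t ∧
    x = C.edgeVert e 0 + s • (C.edgeVert e 1 - C.edgeVert e 0) + t • (c - C.edgeVert e 0)}

/-- Rotating around `e` consistently with its orientation and starting from the triangle `δ₁`,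
the first triangle incident at `e` that is encountered is `δ₂`. (If `δ₁` is the only triangle
incident at `e`, then it is encountered itself, after a full turn.) -/
def NextAround (e : C.Edge) (δ₁ δ₂ : C.Triangle) : Prop :=
  C.Incident e δ₁ ∧ C.Incident e δ₂ ∧
    ∃ θ : ℝ, 0 < θ ∧ θ ≤ 2 * Real.pi ∧
      C.rotateAbout e θ '' C.halfPlane e δ₁ = C.halfPlane e δ₂ ∧
      ∀ φ : ℝ, 0 < φ → φ < θ → ∀ δ : C.Triangle, C.Incident e δ →
        C.rotateAbout e φ '' C.halfPlane e δ₁ ≠ C.halfPlane e δ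

/-- The triangle adjacency graph of the complex. For every edge `e` and all triangles `δ₁`, `δ₂`
which are consecutive around `e`, it has the undirected edge `(v₊(δ₁'), v₋(δ₂'))`, where `δᵢ'` is
`δᵢ` reoriented so as to agree with `e`; thus `v_±(δᵢ')` is `v_±(δᵢ)` if `δᵢ` agrees with `e`
and `v_∓(δᵢ)` if not. -/
def tag : SimpleGraph C.TagVertex :=
  SimpleGraph.fromRel fun v w => ∃ e : C.Edge, ∃ δ₁ δ₂ : C.Triangle, C.NextAround e δ₁ δ₂ ∧
    v = (δ₁, C.incidenceSign e δ₁) ∧ w = (δ₂, -C.incidenceSign e δ₂)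

end OrientedTwoComplex

end

/-! By induction along a path of the graph it suffices to join the two points of one graph edge,
coming from triangles `δ₁`, `δ₂` consecutive around `e`. Take a point `q` of the open triangle `δ₁`
very near the midpoint of `e` and rotate it about `e` until it reaches `δ₂`. Strictly between, the
arc avoids the complex: near the midpoint only cells containing `e` are present, these lie in the
axis and in half-planes of triangles at `e`, and consecutiveness excludes the half-planes at
intermediate angles (`rotateAbout_notMem_space`).

It remains to connect the ends of the arc to the given points. Just off an open triangle one can
slide along its side to a position over the centroid, then along the normal, without meeting the
complex (`joinedIn_point_of_near`). Which side the arc leaves or enters is a sign computation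
(`exists_inner_rotateAbout_sub`): rotation consistent with `e` leaves `δ₁` on the positive side of
`δ₁` reoriented to agree with `e`, and reaches `δ₂` from the negative side. -/

open Filter Topology

/-! ### The cross product -/

lemma cross_add_right (x y z : E3) : cross x (y + z) = cross x y + cross x z := by
  simp [cross]

lemma cross_smul_right (r : ℝ) (x y : E3) : cross x (r • y) = r • cross x y := by
  simp [cross]

lemma cross_smul_left (r : ℝ) (x y : E3) : cross (r • x) y = r • cross x y := by
  simp [cross]

lemma cross_self_right (x : E3) : cross x x = 0 := by
  simp [cross]

lemma inner_eq_sum_three (x y : E3) : inner ℝ x y = x 0 * y 0 + x 1 * y 1 + x 2 * y 2 := by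
  simp [PiLp.inner_apply, Fin.sum_univ_three]; ring

lemma inner_cross_left (x y : E3) : inner ℝ x (cross x y) = 0 := by
  rw [inner_eq_sum_three]; simp [cross, cross_apply]; ring

lemma inner_cross_right (x y : E3) : inner ℝ y (cross x y) = 0 := by
  rw [inner_eq_sum_three]; simp [cross, cross_apply]; ring

lemma cross_cross_self (x y : E3) :
    cross x (cross x y) = (inner ℝ x y) • x - (inner ℝ x x) • y := by
  ext i
  rw [inner_eq_sum_three, inner_eq_sum_three]
  fin_cases i <;> simp [cross, cross_apply] <;> ring

lemma cross_ne_zero {x y : E3} (h : LinearIndependent ℝ ![x, y]) : cross x y ≠ 0 := by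
  intro h0
  have h1 : crossProduct x.ofLp y.ofLp = 0 := by
    have := congrArg WithLp.ofLp h0
    simpa [cross] using this
  refine (crossProduct_ne_zero_iff_linearIndependent.mpr ?_) h1
  rw [LinearIndependent.pair_iff] at h ⊢
  intro s t hst
  refine h s t ?_
  ext i
  simpa using congrFun hst i

/-! ### Rotations about an axis -/

/-- The rotation by the angle `θ` about the axis spanned by the unit vector `u`. -/
noncomputable def axisRotation (u : E3) (θ : ℝ) (v : E3) : E3 :=
  Real.cos θ • v + Real.sin θ • cross u v + ((1 - Real.cos θ) * inner ℝ u v) • u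

lemma axisRotation_add (u : E3) (θ : ℝ) (v w : E3) :
    axisRotation u θ (v + w) = axisRotation u θ v + axisRotation u θ w := by
  simp only [axisRotation, cross_add_right, inner_add_right]
  module

lemma axisRotation_smul (u : E3) (θ r : ℝ) (v : E3) :
    axisRotation u θ (r • v) = r • axisRotation u θ v := by
  simp only [axisRotation, cross_smul_right, inner_smul_right]
  module

lemma axisRotation_axis {u : E3} (hu : inner ℝ u u = (1 : ℝ)) (θ : ℝ) :
    axisRotation u θ u = u := by
  simp only [axisRotation, cross_self_right, hu]
  module

lemma axisRotation_axisRotation {u : E3} (hu : inner ℝ u u = (1 : ℝ)) (ψ φ : ℝ) (v : E3) :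
    axisRotation u ψ (axisRotation u φ v) = axisRotation u (ψ + φ) v := by
  simp only [axisRotation, cross_add_right, cross_smul_right, inner_add_right, inner_smul_right,
    cross_cross_self, cross_self_right, inner_cross_left, hu, Real.cos_add, Real.sin_add]
  module

lemma axisRotation_zero (u v : E3) : axisRotation u 0 v = v := by
  simp [axisRotation]

lemma continuous_axisRotation (u v : E3) : Continuous fun θ => axisRotation u θ v := by
  unfold axisRotation; fun_prop

/-! ### Half-planes -/

/-- The open half-plane through `a` bounded by the line in direction `d`, on the side of `v`. -/
def openHalfPlane (a d v : E3) : Set E3 := {x | ∃ s t : ℝ, 0 < t ∧ x = a + s • d + t • v}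

/-- Any point of the half-plane can replace `v` as spanning direction. Hence two half-planes bounded
by the same line that share a point coincide. -/
lemma openHalfPlane_eq_of_mem {a d v x : E3} (hx : x ∈ openHalfPlane a d v) :
    openHalfPlane a d v = openHalfPlane a d (x - a) := by
  obtain ⟨s, t, ht, rfl⟩ := hx
  ext y
  constructor
  · rintro ⟨s', t', ht', rfl⟩
    refine ⟨s' - t' / t * s, t' / t, by positivity, ?_⟩
    match_scalars <;> field_simp <;> ring
  · rintro ⟨s', t', ht', rfl⟩
    exact ⟨s' + t' * s, t' * t, by positivity, by module⟩

/-! ### Open cells of a simplicial complex -/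

/-- The relative interior of the simplex with vertex set `t`. -/
def openCell (t : Finset E3) : Set E3 :=
  {x | ∃ w : E3 → ℝ, (∀ y ∈ t, 0 < w y) ∧ ∑ y ∈ t, w y = 1 ∧ ∑ y ∈ t, w y • y = x}

lemma openCell_subset_convexHull (t : Finset E3) : openCell t ⊆ convexHull ℝ (t : Set E3) := by
  rintro x ⟨w, hw, h1, rfl⟩
  rw [Finset.mem_convexHull']
  exact ⟨w, fun y hy => (hw y hy).le, h1, rfl⟩

lemma convex_openCell (t : Finset E3) : Convex ℝ (openCell t) := by
  rintro x ⟨w, hw, h1, rfl⟩ y ⟨w', hw', h1', rfl⟩ p q hp hq hpq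
  refine ⟨fun z => p * w z + q * w' z, fun z hz => ?_, ?_, ?_⟩
  · rcases hp.eq_or_lt with rfl | hp
    · have : q = 1 := by linarith
      subst this
      simpa using hw' z hz
    · have := hw z hz
      have := hw' z hz
      positivity
  · rw [Finset.sum_add_distrib, ← Finset.mul_sum, ← Finset.mul_sum, h1, h1']; linarith
  · simp only [add_smul, mul_smul, Finset.sum_add_distrib, Finset.smul_sum]

/-- The point lies in the hull of `t ∩ s`, and barycentric coordinates on `t` are unique, so no
vertex of `t` carrying positive weight can lie outside `s`. -/
lemma subset_of_mem_openCell_of_mem_convexHull (K : Geometry.SimplicialComplex ℝ E3)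
    {t s : Finset E3} (ht : t ∈ K.faces) (hs : s ∈ K.faces) {x : E3} (hxt : x ∈ openCell t)
    (hxs : x ∈ convexHull ℝ (s : Set E3)) : t ⊆ s := by
  classical
  have hx : x ∈ convexHull ℝ ((t ∩ s : Finset E3) : Set E3) := by
    rw [Finset.coe_inter]
    exact K.inter_subset_convexHull ht hs ⟨openCell_subset_convexHull t hxt, hxs⟩
  obtain ⟨w, hw, h1, h2⟩ := hxt
  rw [Finset.mem_convexHull'] at hx
  obtain ⟨w', -, h1', h2'⟩ := hx
  intro y hy
  by_contra hys
  -- Difference of the two barycentric representations of `x`, with `w'` extended by zero off `s`.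
  have hind := affineIndependent_iff.mp (K.indep ht) Finset.univ
    (fun z => w z - if (z : E3) ∈ s then w' z else 0)
  have e1 : ∑ z ∈ t, (if z ∈ s then w' z else 0) = 1 := by
    rw [← h1', ← Finset.sum_filter, Finset.filter_mem_eq_inter]
  have e2 : ∑ z ∈ t, (if z ∈ s then w' z else 0) • z = x := by
    rw [← h2']
    simp only [ite_smul, zero_smul]
    rw [← Finset.sum_filter, Finset.filter_mem_eq_inter]
  have := hind ?_ ?_ ⟨y, hy⟩ (Finset.mem_univ _)
  · simp only [hys, if_false, sub_zero] at this
    exact (hw y hy).ne' this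
  · rw [Finset.sum_coe_sort t (fun z => w z - if z ∈ s then w' z else 0),
      Finset.sum_sub_distrib, h1, e1, sub_self]
  · rw [Finset.sum_coe_sort t (fun z => (w z - if z ∈ s then w' z else 0) • z)]
    simp only [sub_smul]
    rw [Finset.sum_sub_distrib, h2, e2, sub_self]

/-! ### The local geometry of edges and triangles -/

lemma cross_sub_cyclic (p : Fin 3 → E3) (i : Fin 3) :
    cross (p 1 - p 0) (p 2 - p 1) = cross (p (i + 1) - p i) (p (i + 2) - p i) := by
  ext j
  fin_cases i <;> fin_cases j <;> simp [cross, cross_apply] <;> ring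

lemma cross_swap (x y : E3) : cross y x = -cross x y := by
  ext j
  fin_cases j <;> simp [cross, cross_apply] <;> ring

lemma linearIndependent_sub_of_mem {s : Finset E3}
    (hs : AffineIndependent ℝ ((↑) : s → E3)) {a b c : E3} (ha : a ∈ s) (hb : b ∈ s) (hc : c ∈ s)
    (hab : a ≠ b) (hca : c ≠ a) (hcb : c ≠ b) : LinearIndependent ℝ ![b - a, c - a] := by
  classical
  rw [LinearIndependent.pair_iff]
  intro p q hpq
  have h3 := affineIndependent_iff.mp hs {⟨a, ha⟩, ⟨b, hb⟩, ⟨c, hc⟩}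
    (fun z => if (z : E3) = a then -p - q else if (z : E3) = b then p else q)
  rw [Finset.sum_insert (by simp [hab, hca.symm]), Finset.sum_pair (by simp [hcb.symm]),
    Finset.sum_insert (by simp [hab, hca.symm]), Finset.sum_pair (by simp [hcb.symm])] at h3
  simp only [hab.symm, hca, hcb, if_true, if_false] at h3
  have h4 := h3 (by ring) (by rw [← hpq]; module)
  have h5 := h4 ⟨b, hb⟩ (by simp)
  have h6 := h4 ⟨c, hc⟩ (by simp)
  simp only [hab.symm, hca, hcb, if_true, if_false] at h5 h6
  exact ⟨h5, h6⟩

namespace OrientedTwoComplex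

variable {C : OrientedTwoComplex}

lemma coe_edge (e : C.Edge) : (e.1 : Set E3) = {C.edgeVert e 0, C.edgeVert e 1} := by
  rw [← C.range_edgeVert e]
  ext x
  simp [Fin.exists_fin_two, eq_comm]

lemma mem_edge_iff (e : C.Edge) (x : E3) :
    x ∈ e.1 ↔ x = C.edgeVert e 0 ∨ x = C.edgeVert e 1 := by
  rw [← Finset.mem_coe, coe_edge]; simp

lemma edgeVert_ne (e : C.Edge) : C.edgeVert e 0 ≠ C.edgeVert e 1 := by
  intro h
  have h1 : e.1 = {C.edgeVert e 0} := by
    ext x; rw [mem_edge_iff, ← h]; simp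
  have h2 := e.2.2
  rw [h1] at h2
  simp at h2

lemma mem_triangle_iff (δ : C.Triangle) (x : E3) : x ∈ δ.1 ↔ ∃ i, C.triVert δ i = x := by
  rw [← Finset.mem_coe, ← C.range_triVert δ]; rfl

lemma image_triVert (δ : C.Triangle) [DecidableEq E3] :
    Finset.univ.image (C.triVert δ) = δ.1 := by
  ext x; simp [mem_triangle_iff]

lemma triVert_injective (δ : C.Triangle) : Function.Injective (C.triVert δ) := by
  classical
  have h : Set.InjOn (C.triVert δ) (Finset.univ : Finset (Fin 3)) := by
    rw [← Finset.card_image_iff, image_triVert, δ.2.2]; rfl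
  exact fun i j hij => h (by simp) (by simp) hij

lemma Incident.exists_opposite {e : C.Edge} {δ : C.Triangle} (h : C.Incident e δ) :
    ∃ c, c ∈ δ.1 ∧ c ∉ e.1 ∧ ∀ x, x ∈ δ.1 ↔ x = C.edgeVert e 0 ∨ x = C.edgeVert e 1 ∨ x = c := by
  classical
  have hc : (δ.1 \ e.1).card = 1 := by
    rw [Finset.card_sdiff_of_subset h, δ.2.2, e.2.2]
  obtain ⟨c, hc⟩ := Finset.card_eq_one.mp hc
  have hc' : c ∈ δ.1 \ e.1 := by rw [hc]; simp
  rw [Finset.mem_sdiff] at hc'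
  refine ⟨c, hc'.1, hc'.2, fun x => ?_⟩
  have : x ∈ δ.1 \ e.1 ↔ x = c := by rw [hc]; simp
  rw [Finset.mem_sdiff, mem_edge_iff] at this
  have h' := @h x
  rw [mem_edge_iff] at h'
  tauto

lemma linearIndependent_of_incident {e : C.Edge} {δ : C.Triangle} (h : C.Incident e δ) {c : E3}
    (hc : c ∈ δ.1) (hce : c ∉ e.1) :
    LinearIndependent ℝ ![C.edgeVert e 1 - C.edgeVert e 0, c - C.edgeVert e 0] := by
  rw [mem_edge_iff, not_or] at hce
  exact linearIndependent_sub_of_mem (C.cx.indep δ.2.1)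
    (h ((mem_edge_iff e _).mpr (Or.inl rfl))) (h ((mem_edge_iff e _).mpr (Or.inr rfl))) hc
    (edgeVert_ne e) hce.1 hce.2

lemma halfPlane_eq {e : C.Edge} {δ : C.Triangle} (h : C.Incident e δ) {c : E3}
    (hc : c ∈ δ.1) (hce : c ∉ e.1) :
    C.halfPlane e δ =
      openHalfPlane (C.edgeVert e 0) (C.edgeVert e 1 - C.edgeVert e 0) (c - C.edgeVert e 0) := by
  obtain ⟨c', hc', hce', hδ⟩ := h.exists_opposite
  ext x
  constructor
  · rintro ⟨d, hd, hde, hx⟩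
    have : d = c := by
      rw [hδ] at hd hc
      rw [mem_edge_iff] at hde hce
      grind
    subst this
    exact hx
  · intro hx
    exact ⟨c, hc, hce, hx⟩

/-- Links the combinatorial sign to geometry. The normal is invariant under cyclic shifts, so the
vertex list may start at the tail of `e`; the head of `e` then comes second or third, and the latter
swaps the factors of the cross product. -/
lemma cross_triVert_eq {e : C.Edge} {δ : C.Triangle} (h : C.Incident e δ) {c : E3}
    (hc : c ∈ δ.1) (hce : c ∉ e.1) :
    cross (C.triVert δ 1 - C.triVert δ 0) (C.triVert δ 2 - C.triVert δ 1) =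
      ((C.incidenceSign e δ : ℤ) : ℝ) •
        cross (C.edgeVert e 1 - C.edgeVert e 0) (c - C.edgeVert e 0) := by
  obtain ⟨i, hi⟩ := (mem_triangle_iff δ _).mp (h ((mem_edge_iff e _).mpr (Or.inl rfl)))
  obtain ⟨j, hj⟩ := (mem_triangle_iff δ _).mp (h ((mem_edge_iff e _).mpr (Or.inr rfl)))
  obtain ⟨k, hk⟩ := (mem_triangle_iff δ _).mp hc
  have hinj := triVert_injective δ
  rw [mem_edge_iff, not_or] at hce
  have hij : i ≠ j := fun hh => edgeVert_ne e (by rw [← hi, ← hj, hh])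
  have hik : k ≠ i := fun hh => hce.1 (by rw [← hi, ← hk, hh])
  have hjk : k ≠ j := fun hh => hce.2 (by rw [← hj, ← hk, hh])
  rw [cross_sub_cyclic _ i, incidenceSign]
  by_cases hji : j = i + 1
  · have hki : k = i + 2 := by clear * - hij hik hjk hji; decide +revert
    rw [if_pos ⟨i, hi, hji ▸ hj⟩, ← hji, ← hki, hi, hj, hk]
    simp
  · have hji' : j = i + 2 := by clear * - hij hik hjk hji; decide +revert
    have hki : k = i + 1 := by clear * - hij hik hjk hji'; decide +revert
    rw [if_neg, ← hji', ← hki, hi, hj, hk, cross_swap]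
    · simp
    · rintro ⟨i', h1, h2⟩
      have h3 : i' = i := hinj (by rw [h1, hi])
      subst h3
      exact hji (hinj (by rw [hj, h2]))

end OrientedTwoComplex

namespace OrientedTwoComplex

variable {C : OrientedTwoComplex}

/-! ### The two sides of a triangle -/

lemma cross_triVert_ne_zero (δ : C.Triangle) :
    cross (C.triVert δ 1 - C.triVert δ 0) (C.triVert δ 2 - C.triVert δ 1) ≠ 0 := by
  rw [cross_sub_cyclic _ 0]
  have hm := fun i => (mem_triangle_iff δ _).mpr ⟨i, rfl⟩
  have hinj := triVert_injective δ
  exact cross_ne_zero (linearIndependent_sub_of_mem (C.cx.indep δ.2.1) (hm 0) (hm 1) (hm 2)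
    (hinj.ne (by decide)) (hinj.ne (by decide)) (hinj.ne (by decide)))

lemma norm_unitNormal (δ : C.Triangle) : ‖C.unitNormal δ‖ = 1 := by
  rw [unitNormal, norm_smul, norm_inv, norm_norm,
    inv_mul_cancel₀ (norm_ne_zero_iff.mpr (cross_triVert_ne_zero δ))]

lemma inner_unitNormal_self (δ : C.Triangle) :
    inner ℝ (C.unitNormal δ) (C.unitNormal δ) = (1 : ℝ) := by
  rw [real_inner_self_eq_norm_sq, norm_unitNormal, one_pow]

lemma inner_unitNormal_of_mem {δ : C.Triangle} {x : E3} (hx : x ∈ convexHull ℝ (δ.1 : Set E3)) :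
    inner ℝ (C.unitNormal δ) x = (inner ℝ (C.unitNormal δ) (C.triVert δ 0) : ℝ) := by
  have hconv : Convex ℝ {y : E3 | inner ℝ (C.unitNormal δ) y =
      (inner ℝ (C.unitNormal δ) (C.triVert δ 0) : ℝ)} :=
    convex_hyperplane (innerSL ℝ (C.unitNormal δ)).isLinear _
  refine convexHull_min ?_ hconv hx
  intro y hy
  obtain ⟨i, rfl⟩ := (mem_triangle_iff δ y).mp hy
  have h1 : inner ℝ (C.unitNormal δ) (C.triVert δ 1 - C.triVert δ 0) = (0 : ℝ) := by
    rw [unitNormal, cross_sub_cyclic _ 0, real_inner_smul_left, real_inner_comm]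
    exact mul_eq_zero_of_right _ (inner_cross_left _ _)
  have h2 : inner ℝ (C.unitNormal δ) (C.triVert δ 2 - C.triVert δ 0) = (0 : ℝ) := by
    rw [unitNormal, cross_sub_cyclic _ 0, real_inner_smul_left, real_inner_comm]
    exact mul_eq_zero_of_right _ (inner_cross_right _ _)
  rw [inner_sub_right, sub_eq_zero] at h1 h2
  fin_cases i
  · rfl
  · exact h1
  · exact h2

lemma centroid_mem_openCell (δ : C.Triangle) : C.centroid δ ∈ openCell δ.1 := by
  classical
  refine ⟨fun _ => 3⁻¹, fun _ _ => by norm_num, ?_, ?_⟩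
  · rw [Finset.sum_const, δ.2.2]; norm_num
  · rw [← Finset.smul_sum, centroid, ← image_triVert δ,
      Finset.sum_image (fun i _ j _ h => triVert_injective δ h)]

lemma mem_space_of_mem_openCell {δ : C.Triangle} {x : E3} (hx : x ∈ openCell δ.1) :
    x ∈ C.cx.space :=
  C.cx.convexHull_subset_space δ.2.1 (openCell_subset_convexHull _ hx)

/-- The union of the cells of the complex that satisfy `p` is closed. -/
lemma isClosed_biUnion_faces (C : OrientedTwoComplex) (p : Finset E3 → Prop) :
    IsClosed (⋃ s ∈ {s | s ∈ C.cx.faces ∧ p s}, convexHull ℝ (s : Set E3)) :=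
  (C.finite_faces.subset fun _ h => h.1).isClosed_biUnion
    fun s _ => s.finite_toSet.isClosed_convexHull (𝕜 := ℝ)

lemma add_smul_mem_segment (g n : E3) {k r : ℝ} (hr : 0 < r) (hk : -r ≤ k) (hk' : k ≤ r) :
    g + k • n ∈ segment ℝ (g + (-r) • n) (g + r • n) := by
  refine ⟨(r - k) / (2 * r), (r + k) / (2 * r), div_nonneg (by linarith) (by linarith),
    div_nonneg (by linarith) (by linarith), by field_simp; ring, ?_⟩
  match_scalars <;> field_simp <;> ring

/-- The segment from the centroid to `q` is compact and misses the closed union `F` of the other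
cells, so a tube around it does too. The part of the tube on the `σ` side of the plane of `δ` is
convex and misses `δ` as well. -/
lemma joinedIn_point_of_near {T : Set E3} (hC : C.cx.space ⊆ interior T) {ε : C.Triangle → ℝ}
    (hε : C.AdmissibleOffset T ε) (δ : C.Triangle) (σ : ℤˣ) {q : E3} (hq : q ∈ openCell δ.1) :
    ∃ r > 0, ∀ z ∈ Metric.ball q r,
      0 < ((σ : ℤ) : ℝ) * (inner ℝ (C.unitNormal δ) (z - q) : ℝ) →
      JoinedIn (T \ C.cx.space) z (C.point ε (δ, σ)) := by
  set n := C.unitNormal δ with hn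
  set g := C.centroid δ with hg
  obtain ⟨hε0, hεT, hεs⟩ := hε δ
  have hp1 : C.point ε (δ, 1) = g + ε δ • n := by simp [point, hg, hn]
  have hp2 : C.point ε (δ, -1) = g + (-ε δ) • n := by simp [point, hg, hn]
  have hσ : ((σ : ℤ) : ℝ) * ((σ : ℤ) : ℝ) = 1 := by
    rcases Int.units_eq_one_or σ with rfl | rfl <;> simp
  set F : Set E3 := ⋃ s ∈ {s | s ∈ C.cx.faces ∧ s ≠ δ.1}, convexHull ℝ (s : Set E3) with hF
  set H : Set E3 := {y | 0 < ((σ : ℤ) : ℝ) * (inner ℝ n (y - q) : ℝ)} with hH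
  have hHconv : Convex ℝ H := by
    have : H = {y | ((σ : ℤ) : ℝ) * inner ℝ n q < (((σ : ℤ) : ℝ) • innerSL ℝ n) y} := by
      ext y
      simp [hH, inner_sub_right, mul_sub]
    rw [this]
    exact convex_halfSpace_gt (((σ : ℤ) : ℝ) • innerSL ℝ n).isLinear _
  have hHδ : ∀ y ∈ H, y ∉ convexHull ℝ (δ.1 : Set E3) := by
    intro y hy hyδ
    have : inner ℝ n (y - q) = (0 : ℝ) := by
      rw [inner_sub_right, inner_unitNormal_of_mem hyδ,
        inner_unitNormal_of_mem (openCell_subset_convexHull _ hq), sub_self]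
    rw [hH, Set.mem_ofPred_eq, this] at hy
    simp at hy
  have hsp : ∀ y ∈ H, y ∉ F → y ∉ C.cx.space := by
    intro y hy hyF hys
    obtain ⟨s, hs, hys⟩ := C.cx.mem_space_iff.mp hys
    by_cases hsδ : s = δ.1
    · exact hHδ y hy (hsδ ▸ hys)
    · exact hyF (Set.mem_biUnion (show s ∈ {s | s ∈ C.cx.faces ∧ s ≠ δ.1} from ⟨hs, hsδ⟩) hys)
  have hUo : IsOpen (interior T \ F) := isOpen_interior.sdiff (isClosed_biUnion_faces C _)
  have hcell : openCell δ.1 ⊆ interior T \ F := by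
    intro x hx
    refine ⟨hC (mem_space_of_mem_openCell hx), fun hxF => ?_⟩
    obtain ⟨s, ⟨hs, hsδ⟩, hxs⟩ := Set.mem_iUnion₂.mp hxF
    -- A cell meeting the open triangle contains all its vertices, hence equals it, as no cell has
    -- more than three.
    have hsub := subset_of_mem_openCell_of_mem_convexHull C.cx δ.2.1 hs hx hxs
    exact hsδ (Finset.eq_of_subset_of_card_le hsub
      ((C.card_le_three s hs).trans δ.2.2.ge)).symm
  have hgm : g ∈ openCell δ.1 := centroid_mem_openCell δ
  have hK : segment ℝ g q ⊆ interior T \ F :=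
    ((convex_openCell δ.1).segment_subset hgm hq).trans hcell
  have hKc : IsCompact (segment ℝ g q) := by
    rw [← convexHull_pair]
    exact (Set.toFinite {g, q}).isCompact_convexHull (𝕜 := ℝ)
  obtain ⟨r, hr, hrU⟩ := hKc.exists_thickening_subset_open hUo hK
  refine ⟨r, hr, fun z hz hzH => ?_⟩
  have hgH : ∀ k : ℝ, 0 < k → g + (((σ : ℤ) : ℝ) * k) • n ∈ H := by
    intro k hk
    have h1 : inner ℝ n g = (inner ℝ n q : ℝ) := by
      rw [inner_unitNormal_of_mem (openCell_subset_convexHull _ hgm),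
        inner_unitNormal_of_mem (openCell_subset_convexHull _ hq)]
    rw [hH, Set.mem_ofPred_eq, inner_sub_right, inner_add_right, h1, inner_smul_right,
      inner_unitNormal_self, add_sub_cancel_left, mul_one, ← mul_assoc, hσ, one_mul]
    exact hk
  have hseg : ∀ k : ℝ, 0 < k → k ≤ ε δ → g + (((σ : ℤ) : ℝ) * k) • n ∈
      segment ℝ (C.point ε (δ, -1)) (C.point ε (δ, 1)) := by
    intro k hk hkε
    rw [hp1, hp2]
    rcases Int.units_eq_one_or σ with rfl | rfl
    · exact add_smul_mem_segment g n hε0 (by simp; linarith) (by simpa using hkε)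
    · exact add_smul_mem_segment g n hε0 (by simpa using hkε) (by simp; linarith)
  -- Height of the corner of the path over the centroid: below `r` to stay in the tube, at most `ε
  -- δ` to lie on the admissible segment.
  set k := min (r / 2) (ε δ) with hk
  have hk0 : 0 < k := lt_min (by linarith) hε0
  have hy1 : g + (((σ : ℤ) : ℝ) * k) • n ∈ Metric.thickening r (segment ℝ g q) := by
    rw [Metric.mem_thickening_iff]
    refine ⟨g, left_mem_segment ℝ g q, ?_⟩
    have : |((σ : ℤ) : ℝ)| = 1 := by
      rcases Int.units_eq_one_or σ with rfl | rfl <;> simp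
    rw [dist_eq_norm, add_sub_cancel_left, norm_smul, norm_unitNormal, Real.norm_eq_abs, abs_mul,
      this, abs_of_pos hk0]
    have := min_le_left (r / 2) (ε δ)
    linarith
  have hz1 : z ∈ Metric.thickening r (segment ℝ g q) :=
    Metric.mem_thickening_iff.mpr ⟨q, right_mem_segment ℝ g q, hz⟩
  refine (JoinedIn.of_segment_subset (y := g + (((σ : ℤ) : ℝ) * k) • n) ?_).trans
    (JoinedIn.of_segment_subset ?_)
  · intro y hy
    have hyW := (((convex_segment (𝕜 := ℝ) g q).thickening r).inter hHconv).segment_subset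
      ⟨hz1, hzH⟩ ⟨hy1, hgH k hk0⟩ hy
    have hyU := hrU hyW.1
    exact ⟨interior_subset hyU.1, hsp y hyW.2 hyU.2⟩
  · intro y hy
    have hyW := ((convex_segment (𝕜 := ℝ) _ _).inter hHconv).segment_subset
      ⟨hseg k hk0 (min_le_right _ _), hgH k hk0⟩ ⟨hseg (ε δ) hε0 le_rfl, hgH _ hε0⟩ hy
    refine ⟨hεT hyW.1, hsp y hyW.2 fun hyF => ?_⟩
    obtain ⟨s, ⟨hs, hsδ⟩, hys⟩ := Set.mem_iUnion₂.mp hyF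
    exact Set.disjoint_left.mp (hεs s hs hsδ) hyW.1 hys

end OrientedTwoComplex

/-! ### Rotation about an edge and shrinking towards its midpoint -/

lemma exists_of_mem_convexHull {A : Set E3} {a d v : E3}
    (hA : ∀ y ∈ A, ∃ s t : ℝ, 0 ≤ t ∧ y = a + s • d + t • v) {x : E3}
    (hx : x ∈ convexHull ℝ A) : ∃ s t : ℝ, 0 ≤ t ∧ x = a + s • d + t • v := by
  have hconv : Convex ℝ {y : E3 | ∃ s t : ℝ, 0 ≤ t ∧ y = a + s • d + t • v} := by
    rintro _ ⟨s, t, ht, rfl⟩ _ ⟨s', t', ht', rfl⟩ p q hp hq hpq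
    refine ⟨p * s + q * s', p * t + q * t', by positivity, ?_⟩
    obtain rfl : q = 1 - p := by linarith
    module
  exact convexHull_min hA hconv hx

namespace OrientedTwoComplex

variable {C : OrientedTwoComplex}

/-- The unit vector in the direction of an oriented edge. -/
noncomputable def edgeDir (e : C.Edge) : E3 :=
  ‖C.edgeVert e 1 - C.edgeVert e 0‖⁻¹ • (C.edgeVert e 1 - C.edgeVert e 0)

lemma norm_edge_pos (e : C.Edge) : 0 < ‖C.edgeVert e 1 - C.edgeVert e 0‖ :=
  norm_pos_iff.mpr (sub_ne_zero.mpr (edgeVert_ne e).symm)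

lemma inner_edgeDir_self (e : C.Edge) : inner ℝ (C.edgeDir e) (C.edgeDir e) = (1 : ℝ) := by
  rw [real_inner_self_eq_norm_sq, edgeDir, norm_smul, norm_inv, norm_norm,
    inv_mul_cancel₀ (norm_edge_pos e).ne', one_pow]

lemma norm_smul_edgeDir (e : C.Edge) :
    ‖C.edgeVert e 1 - C.edgeVert e 0‖ • C.edgeDir e = C.edgeVert e 1 - C.edgeVert e 0 := by
  rw [edgeDir, smul_smul, mul_inv_cancel₀ (norm_edge_pos e).ne', one_smul]

lemma rotateAbout_eq (e : C.Edge) (θ : ℝ) (x : E3) :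
    C.rotateAbout e θ x = C.edgeVert e 0 + axisRotation (C.edgeDir e) θ (x - C.edgeVert e 0) :=
  rfl

lemma rotateAbout_zero (e : C.Edge) (x : E3) : C.rotateAbout e 0 x = x := by
  rw [rotateAbout_eq, axisRotation_zero, add_sub_cancel]

lemma rotateAbout_rotateAbout (e : C.Edge) (ψ φ : ℝ) (x : E3) :
    C.rotateAbout e ψ (C.rotateAbout e φ x) = C.rotateAbout e (ψ + φ) x := by
  simp only [rotateAbout_eq, add_sub_cancel_left,
    axisRotation_axisRotation (inner_edgeDir_self e)]

lemma continuous_rotateAbout (e : C.Edge) (x : E3) : Continuous fun θ => C.rotateAbout e θ x := by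
  simp only [rotateAbout_eq]
  exact continuous_const.add (continuous_axisRotation _ _)

lemma axisRotation_edge (e : C.Edge) (θ : ℝ) :
    axisRotation (C.edgeDir e) θ (C.edgeVert e 1 - C.edgeVert e 0) =
      C.edgeVert e 1 - C.edgeVert e 0 := by
  rw [← norm_smul_edgeDir, axisRotation_smul, axisRotation_axis (inner_edgeDir_self e)]

lemma rotateAbout_add_smul (e : C.Edge) (θ s t : ℝ) (v : E3) :
    C.rotateAbout e θ (C.edgeVert e 0 + s • (C.edgeVert e 1 - C.edgeVert e 0) + t • v) =
      C.edgeVert e 0 + s • (C.edgeVert e 1 - C.edgeVert e 0) +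
        t • axisRotation (C.edgeDir e) θ v := by
  rw [rotateAbout_eq, add_assoc, add_sub_cancel_left, axisRotation_add, axisRotation_smul,
    axisRotation_smul, axisRotation_edge, add_assoc]

lemma rotateAbout_image_openHalfPlane (e : C.Edge) (θ : ℝ) (v : E3) :
    C.rotateAbout e θ ''
        openHalfPlane (C.edgeVert e 0) (C.edgeVert e 1 - C.edgeVert e 0) v =
      openHalfPlane (C.edgeVert e 0) (C.edgeVert e 1 - C.edgeVert e 0)
        (axisRotation (C.edgeDir e) θ v) := by
  ext y
  constructor
  · rintro ⟨_, ⟨s, t, ht, rfl⟩, rfl⟩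
    exact ⟨s, t, ht, rotateAbout_add_smul e θ s t v⟩
  · rintro ⟨s, t, ht, rfl⟩
    exact ⟨_, ⟨s, t, ht, rfl⟩, rotateAbout_add_smul e θ s t v⟩

/-- The midpoint of an edge. -/
noncomputable def edgeMid (e : C.Edge) : E3 :=
  C.edgeVert e 0 + (2⁻¹ : ℝ) • (C.edgeVert e 1 - C.edgeVert e 0)

lemma edgeMid_add_smul (e : C.Edge) (r s t : ℝ) (v : E3) :
    C.edgeMid e + r • (C.edgeVert e 0 + s • (C.edgeVert e 1 - C.edgeVert e 0) + t • v -
      C.edgeMid e) = C.edgeVert e 0 + (2⁻¹ + r * (s - 2⁻¹)) •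
        (C.edgeVert e 1 - C.edgeVert e 0) + (r * t) • v := by
  rw [edgeMid]; module

lemma edgeMid_mem_openCell (e : C.Edge) : C.edgeMid e ∈ openCell e.1 := by
  classical
  have he : e.1 = {C.edgeVert e 0, C.edgeVert e 1} := by
    ext x; simp [mem_edge_iff]
  refine ⟨fun _ => 2⁻¹, fun _ _ => by norm_num, ?_, ?_⟩
  · rw [Finset.sum_const, e.2.2]; norm_num
  · rw [he, Finset.sum_pair (edgeVert_ne e), edgeMid]
    module

lemma mem_openCell_of_incident {e : C.Edge} {δ : C.Triangle} (h : C.Incident e δ) {c : E3}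
    (hc : c ∈ δ.1) (hce : c ∉ e.1) {s t : ℝ} (hs : 0 < s) (ht : 0 < t) (hst : s + t < 1) :
    C.edgeVert e 0 + s • (C.edgeVert e 1 - C.edgeVert e 0) + t • (c - C.edgeVert e 0) ∈
      openCell δ.1 := by
  classical
  obtain ⟨c', hc', hce', hδ⟩ := h.exists_opposite
  have hcc : c' = c := by
    rw [hδ] at hc
    rw [mem_edge_iff] at hce
    tauto
  subst hcc
  have hδ' : δ.1 = {C.edgeVert e 0, C.edgeVert e 1, c'} := by ext x; simp [hδ]
  rw [mem_edge_iff, not_or] at hce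
  have hab := edgeVert_ne e
  have h1 : C.edgeVert e 0 ∉ ({C.edgeVert e 1, c'} : Finset E3) := by
    simp [hab, Ne.symm hce.1]
  refine ⟨fun y => if y = C.edgeVert e 0 then 1 - s - t else if y = C.edgeVert e 1 then s else t,
    fun y _ => ?_, ?_, ?_⟩
  · dsimp only
    split_ifs <;> linarith
  · rw [hδ', Finset.sum_insert h1, Finset.sum_pair (Ne.symm hce.2)]
    simp only [hab.symm, hce.1, hce.2, if_true, if_false]
    ring
  · rw [hδ', Finset.sum_insert h1, Finset.sum_pair (Ne.symm hce.2)]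
    simp only [hab.symm, hce.1, hce.2, if_true, if_false]
    module

/-- Shrinking towards the midpoint sends the coordinates `(s, t)` to `(1/2, 0)` while keeping the
second one positive, so they end up inside the open triangle. -/
lemma eventually_mem_openCell {e : C.Edge} {δ : C.Triangle} (h : C.Incident e δ) {x : E3}
    (hx : x ∈ C.halfPlane e δ) :
    ∀ᶠ r : ℝ in 𝓝[>] 0, C.edgeMid e + r • (x - C.edgeMid e) ∈ openCell δ.1 := by
  obtain ⟨c, hc, hce, -⟩ := h.exists_opposite
  rw [halfPlane_eq h hc hce] at hx
  obtain ⟨s, t, ht, rfl⟩ := hx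
  have h1 : ∀ᶠ r : ℝ in 𝓝 0, 0 < 2⁻¹ + r * (s - 2⁻¹) :=
    ContinuousAt.eventually_lt (by fun_prop) (by fun_prop) (by norm_num)
  have h2 : ∀ᶠ r : ℝ in 𝓝 0, 2⁻¹ + r * (s - 2⁻¹) + r * t < 1 :=
    ContinuousAt.eventually_lt (by fun_prop) (by fun_prop) (by norm_num)
  filter_upwards [nhdsWithin_le_nhds h1, nhdsWithin_le_nhds h2, self_mem_nhdsWithin]
    with r hr1 hr2 hr
  rw [edgeMid_add_smul]
  exact mem_openCell_of_incident h hc hce hr1 (mul_pos hr ht) hr2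

/-! ### Turning a triangle slightly about one of its edges -/

/-- The normal is a multiple of `cross u v`, which is orthogonal to `u` and `v`, so only the sine
term of the rotation formula survives. -/
lemma exists_inner_rotateAbout_sub {e : C.Edge} {δ : C.Triangle} (h : C.Incident e δ) {q : E3}
    (hq : q ∈ C.halfPlane e δ) :
    ∃ κ : ℝ, 0 < κ ∧ ∀ ψ : ℝ, (inner ℝ (C.unitNormal δ) (C.rotateAbout e ψ q - q) : ℝ) =
      ((C.incidenceSign e δ : ℤ) : ℝ) * (κ * Real.sin ψ) := by
  obtain ⟨c, hc, hce, -⟩ := h.exists_opposite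
  rw [halfPlane_eq h hc hce] at hq
  obtain ⟨s, t, ht, rfl⟩ := hq
  have hN := cross_ne_zero (linearIndependent_of_incident h hc hce)
  have hn := cross_triVert_eq h hc hce
  rw [← norm_smul_edgeDir, cross_smul_left] at hN hn
  have hl := norm_edge_pos e
  have hrot := fun ψ => rotateAbout_add_smul e ψ s t (c - C.edgeVert e 0)
  set ℓ := ‖C.edgeVert e 1 - C.edgeVert e 0‖
  set u := C.edgeDir e
  set v := c - C.edgeVert e 0
  have hM : 0 < (inner ℝ (cross u v) (cross u v) : ℝ) :=
    real_inner_self_pos.mpr (smul_ne_zero_iff.mp hN).2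
  set ν := ‖cross (C.triVert δ 1 - C.triVert δ 0) (C.triVert δ 2 - C.triVert δ 1)‖⁻¹ with hν
  have hν0 : 0 < ν := inv_pos.mpr (norm_pos_iff.mpr (cross_triVert_ne_zero δ))
  refine ⟨ν * ℓ * t * inner ℝ (cross u v) (cross u v), by positivity, fun ψ => ?_⟩
  have hnn : C.unitNormal δ = (ν * ((C.incidenceSign e δ : ℤ) : ℝ) * ℓ) • cross u v := by
    rw [unitNormal, ← hν, hn]; module
  have h1 : inner ℝ (cross u v) v = (0 : ℝ) := by rw [real_inner_comm, inner_cross_right]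
  have h2 : inner ℝ (cross u v) u = (0 : ℝ) := by rw [real_inner_comm, inner_cross_left]
  rw [hrot, add_sub_add_left_eq_sub, ← smul_sub, hnn, axisRotation]
  simp only [real_inner_smul_left, inner_smul_right, inner_sub_right, inner_add_right, h1, h2]
  ring

lemma eventually_joinedIn_point {T : Set E3} (hC : C.cx.space ⊆ interior T) {ε : C.Triangle → ℝ}
    (hε : C.AdmissibleOffset T ε) {e : C.Edge} {δ : C.Triangle} (h : C.Incident e δ) {q : E3}
    (hq : q ∈ openCell δ.1) (hq' : q ∈ C.halfPlane e δ) (τ : ℤˣ) :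
    ∀ᶠ ψ : ℝ in 𝓝[>] 0, JoinedIn (T \ C.cx.space)
      (C.rotateAbout e (((τ : ℤ) : ℝ) * ψ) q) (C.point ε (δ, τ * C.incidenceSign e δ)) := by
  obtain ⟨κ, hκ, hinner⟩ := exists_inner_rotateAbout_sub h hq'
  obtain ⟨r, hr, hj⟩ := joinedIn_point_of_near hC hε δ (τ * C.incidenceSign e δ) hq
  have hcont : Tendsto (fun ψ : ℝ => C.rotateAbout e (((τ : ℤ) : ℝ) * ψ) q) (𝓝 0) (𝓝 q) := by
    have := ((continuous_rotateAbout e q).comp (continuous_const_mul ((τ : ℤ) : ℝ))).tendsto 0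
    simpa [rotateAbout_zero, Function.comp_def] using this
  filter_upwards [nhdsWithin_le_nhds (hcont (Metric.ball_mem_nhds q hr)),
    Ioo_mem_nhdsGT Real.pi_pos] with ψ hψ1 hψ2
  refine hj _ hψ1 ?_
  rw [hinner]
  have hs := Real.sin_pos_of_pos_of_lt_pi hψ2.1 hψ2.2
  have hpos := mul_pos hκ hs
  rcases Int.units_eq_one_or τ with rfl | rfl <;>
    rcases Int.units_eq_one_or (C.incidenceSign e δ) with h' | h' <;> simpa [h'] using hpos

/-! ### Near the midpoint of an edge -/

/-- The midpoint is in the open cell of `e`, so it avoids the closed union of the finitely many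
cells not containing `e`. -/
lemma exists_ball_edgeMid {T : Set E3} (hC : C.cx.space ⊆ interior T) (e : C.Edge) :
    ∃ ρ > 0, Metric.ball (C.edgeMid e) ρ ⊆ T ∧ ∀ s ∈ C.cx.faces,
      ∀ x ∈ Metric.ball (C.edgeMid e) ρ, x ∈ convexHull ℝ (s : Set E3) → e.1 ⊆ s := by
  have hm := edgeMid_mem_openCell e
  have hopen := (isOpen_interior (s := T)).sdiff (isClosed_biUnion_faces C fun s => ¬ e.1 ⊆ s)
  have hmem : C.edgeMid e ∈ interior T \
      ⋃ s ∈ {s | s ∈ C.cx.faces ∧ ¬ e.1 ⊆ s}, convexHull ℝ (s : Set E3) := by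
    refine ⟨hC (C.cx.convexHull_subset_space e.2.1 (openCell_subset_convexHull _ hm)), fun hF => ?_⟩
    obtain ⟨s, ⟨hs, hes⟩, hms⟩ := Set.mem_iUnion₂.mp hF
    exact hes (subset_of_mem_openCell_of_mem_convexHull C.cx e.2.1 hs hm hms)
  obtain ⟨ρ, hρ, hball⟩ := Metric.isOpen_iff.mp hopen _ hmem
  refine ⟨ρ, hρ, fun x hx => interior_subset (hball hx).1, fun s hs x hx hxs => ?_⟩
  by_contra hes
  exact (hball hx).2
    (Set.mem_biUnion (show s ∈ {s | s ∈ C.cx.faces ∧ ¬ e.1 ⊆ s} from ⟨hs, hes⟩) hxs)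

/-- A cell containing the edge `e` lies in the union of the line through `e` and the half-planes of
the triangles incident at `e`. -/
lemma mem_line_or_mem_halfPlane {e : C.Edge} {s : Finset E3} (hs : s ∈ C.cx.faces)
    (hes : e.1 ⊆ s) {x : E3} (hx : x ∈ convexHull ℝ (s : Set E3)) :
    (∃ r : ℝ, x = C.edgeVert e 0 + r • (C.edgeVert e 1 - C.edgeVert e 0)) ∨
      ∃ δ : C.Triangle, C.Incident e δ ∧ x ∈ C.halfPlane e δ := by
  have hcard := Finset.card_le_card hes
  rw [e.2.2] at hcard
  have hcases : s.card = 2 ∨ s.card = 3 := by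
    have := C.card_le_three s hs
    omega
  rcases hcases with h2 | h3
  · left
    obtain rfl := Finset.eq_of_subset_of_card_le hes (by rw [h2, e.2.2])
    have hA : ∀ y ∈ (e.1 : Set E3), ∃ r t : ℝ, 0 ≤ t ∧ y = C.edgeVert e 0 +
        r • (C.edgeVert e 1 - C.edgeVert e 0) + t • (0 : E3) := by
      intro y hy
      rcases (mem_edge_iff e y).mp hy with rfl | rfl
      · exact ⟨0, 0, le_rfl, by simp⟩
      · exact ⟨1, 0, le_rfl, by simp⟩
    obtain ⟨r, t, -, hrt⟩ := exists_of_mem_convexHull hA hx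
    exact ⟨r, by simpa using hrt⟩
  · have hinc : C.Incident e ⟨s, hs, h3⟩ := hes
    obtain ⟨c, hc, hce, hδ⟩ := hinc.exists_opposite
    have hA : ∀ y ∈ (s : Set E3), ∃ r t : ℝ, 0 ≤ t ∧ y = C.edgeVert e 0 +
        r • (C.edgeVert e 1 - C.edgeVert e 0) + t • (c - C.edgeVert e 0) := by
      intro y hy
      rcases (hδ y).mp hy with rfl | rfl | rfl
      · exact ⟨0, 0, le_rfl, by simp⟩
      · exact ⟨1, 0, le_rfl, by simp⟩
      · exact ⟨0, 1, zero_le_one, by simp⟩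
    obtain ⟨r, t, ht, hrt⟩ := exists_of_mem_convexHull hA hx
    rcases ht.eq_or_lt with rfl | ht
    · exact Or.inl ⟨r, by simpa using hrt⟩
    · exact Or.inr ⟨_, hinc, c, hc, hce, r, t, ht, hrt⟩

lemma rotateAbout_ne_line {e : C.Edge} {δ : C.Triangle} (h : C.Incident e δ) {x : E3}
    (hx : x ∈ C.halfPlane e δ) (φ r : ℝ) :
    C.rotateAbout e φ x ≠ C.edgeVert e 0 + r • (C.edgeVert e 1 - C.edgeVert e 0) := by
  intro heq
  obtain ⟨c, hc, hce, -⟩ := h.exists_opposite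
  rw [halfPlane_eq h hc hce] at hx
  obtain ⟨s, t, ht, rfl⟩ := hx
  -- Rotating back fixes the axis and would put `x` itself on it.
  have h1 := congrArg (C.rotateAbout e (-φ)) heq
  have h2 := rotateAbout_add_smul e (-φ) r 0 0
  simp only [zero_smul, add_zero] at h2
  rw [rotateAbout_rotateAbout, neg_add_cancel, rotateAbout_zero, h2] at h1
  have h3 := LinearIndependent.pair_iff.mp (linearIndependent_of_incident h hc hce) (s - r) t (by
    rw [← sub_eq_zero] at h1
    rw [← h1]; module)
  exact ht.ne' h3.2

lemma rotateAbout_notMem_space {e : C.Edge} {δ₁ : C.Triangle} (h : C.Incident e δ₁) {ρ : ℝ}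
    (hρ : ∀ s ∈ C.cx.faces,
      ∀ x ∈ Metric.ball (C.edgeMid e) ρ, x ∈ convexHull ℝ (s : Set E3) → e.1 ⊆ s)
    {φ : ℝ} (hφ : ∀ δ : C.Triangle, C.Incident e δ →
      C.rotateAbout e φ '' C.halfPlane e δ₁ ≠ C.halfPlane e δ)
    {q : E3} (hq : q ∈ C.halfPlane e δ₁)
    (hball : C.rotateAbout e φ q ∈ Metric.ball (C.edgeMid e) ρ) :
    C.rotateAbout e φ q ∉ C.cx.space := by
  intro hsp
  obtain ⟨s, hs, hys⟩ := C.cx.mem_space_iff.mp hsp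
  rcases mem_line_or_mem_halfPlane hs (hρ s hs _ hball hys) hys with ⟨r, hr⟩ | ⟨δ, hδ, hyδ⟩
  · exact rotateAbout_ne_line h hq φ r hr
  · refine hφ δ hδ ?_
    have hy := Set.mem_image_of_mem (C.rotateAbout e φ) hq
    obtain ⟨c, hc, hce, -⟩ := h.exists_opposite
    obtain ⟨c', hc', hce', -⟩ := hδ.exists_opposite
    rw [halfPlane_eq h hc hce, rotateAbout_image_openHalfPlane] at hy ⊢
    rw [halfPlane_eq hδ hc' hce'] at hyδ ⊢
    rw [openHalfPlane_eq_of_mem hy, openHalfPlane_eq_of_mem hyδ]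

lemma rotateAbout_edgeMid_add_smul (e : C.Edge) (φ r : ℝ) (x : E3) :
    C.rotateAbout e φ (C.edgeMid e + r • (x - C.edgeMid e)) =
      C.edgeMid e + r • (C.rotateAbout e φ x - C.edgeMid e) := by
  have h0 : x = C.edgeVert e 0 + (0 : ℝ) • (C.edgeVert e 1 - C.edgeVert e 0) +
      (1 : ℝ) • (x - C.edgeVert e 0) := by module
  rw [h0, edgeMid_add_smul, rotateAbout_add_smul, rotateAbout_add_smul, edgeMid_add_smul]

lemma edgeMid_add_smul_mem_halfPlane {e : C.Edge} {δ : C.Triangle} {x : E3}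
    (hx : x ∈ C.halfPlane e δ) {r : ℝ} (hr : 0 < r) :
    C.edgeMid e + r • (x - C.edgeMid e) ∈ C.halfPlane e δ := by
  obtain ⟨c, hc, hce, s, t, ht, rfl⟩ := hx
  exact ⟨c, hc, hce, _, _, mul_pos hr ht, edgeMid_add_smul e r s t _⟩

/-- The two points that belong to the ends of an edge of the triangle adjacency graph can be joined
in the complement of the complex. -/
lemma joinedIn_point_of_nextAround {T : Set E3} (hC : C.cx.space ⊆ interior T)
    {ε : C.Triangle → ℝ} (hε : C.AdmissibleOffset T ε) {e : C.Edge} {δ₁ δ₂ : C.Triangle}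
    (h : C.NextAround e δ₁ δ₂) :
    JoinedIn (T \ C.cx.space) (C.point ε (δ₁, C.incidenceSign e δ₁))
      (C.point ε (δ₂, -C.incidenceSign e δ₂)) := by
  obtain ⟨h1, h2, θ, hθ0, -, himg, hnot⟩ := h
  obtain ⟨ρ, hρ, hρT, hρs⟩ := exists_ball_edgeMid hC e
  obtain ⟨c, hc, hce, -⟩ := h1.exists_opposite
  have hx1 : c ∈ C.halfPlane e δ₁ := ⟨c, hc, hce, 0, 1, one_pos, by simp⟩
  have hx2 : C.rotateAbout e θ c ∈ C.halfPlane e δ₂ := himg ▸ Set.mem_image_of_mem _ hx1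
  -- `M` bounds the distance from the midpoint to the arc swept by `c`. Shrinking commutes with the
  -- rotation, so a factor `r` with `r * M < ρ` brings the whole arc into the ball.
  obtain ⟨M, hM⟩ := (isCompact_Icc (a := (0 : ℝ)) (b := θ)).exists_bound_of_continuousOn
    (((continuous_rotateAbout e c).sub continuous_const).continuousOn
      (f := fun φ => C.rotateAbout e φ c - C.edgeMid e))
  have hev : ∀ᶠ r : ℝ in 𝓝[>] 0, r * M < ρ :=
    nhdsWithin_le_nhds
      (ContinuousAt.eventually_lt (by fun_prop) (by fun_prop) (by simpa using hρ))
  obtain ⟨r, hrM, hr1, hr2, hr0⟩ := (hev.and ((eventually_mem_openCell h1 hx1).and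
    ((eventually_mem_openCell h2 hx2).and self_mem_nhdsWithin))).exists
  set q := C.edgeMid e + r • (c - C.edgeMid e) with hq
  have hqh : q ∈ C.halfPlane e δ₁ := edgeMid_add_smul_mem_halfPlane hx1 hr0
  have hq2h := edgeMid_add_smul_mem_halfPlane hx2 hr0
  rw [← rotateAbout_edgeMid_add_smul, ← hq] at hr2 hq2h
  have harc : ∀ φ ∈ Set.Ioo 0 θ, C.rotateAbout e φ q ∈ T \ C.cx.space := by
    intro φ hφ
    have hball : C.rotateAbout e φ q ∈ Metric.ball (C.edgeMid e) ρ := by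
      rw [hq, rotateAbout_edgeMid_add_smul, mem_ball_iff_norm, add_sub_cancel_left, norm_smul,
        Real.norm_of_nonneg hr0.le]
      exact (mul_le_mul_of_nonneg_left (hM φ ⟨hφ.1.le, hφ.2.le⟩) hr0.le).trans_lt hrM
    exact ⟨hρT hball, rotateAbout_notMem_space h1 hρs (hnot φ hφ.1 hφ.2) hqh hball⟩
  -- Forward turn from `δ₁`, backward turn from `δ₂`; one small `ψ` serves both.
  have hj1 := eventually_joinedIn_point hC hε h1 hr1 hqh 1
  have hj2 := eventually_joinedIn_point hC hε h2 hr2 hq2h (-1)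
  obtain ⟨ψ, ⟨hψ1, hψ2⟩, hψ0, hψθ⟩ := ((hj1.and hj2).and (Ioo_mem_nhdsGT hθ0)).exists
  simp only [rotateAbout_rotateAbout, Units.val_neg, Units.val_one, Int.cast_neg, Int.cast_one,
    one_mul, neg_mul] at hψ1 hψ2
  refine (hψ1.symm.trans ?_).trans hψ2
  have hpc : IsPathConnected ((fun φ => C.rotateAbout e φ q) '' Set.Ioo 0 θ) :=
    ((convex_Ioo 0 θ).isPathConnected ⟨ψ, hψ0, hψθ⟩).image (continuous_rotateAbout e q)
  exact (hpc.joinedIn _ ⟨ψ, ⟨hψ0, hψθ⟩, rfl⟩ _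
    ⟨-ψ + θ, ⟨by linarith, by linarith⟩, rfl⟩).mono (Set.image_subset_iff.mpr harc)

/-- Needed for the trivial path; membership is read off as the endpoint of a path starting just
above the centroid. -/
lemma point_mem {T : Set E3} (hC : C.cx.space ⊆ interior T) {ε : C.Triangle → ℝ}
    (hε : C.AdmissibleOffset T ε) (v : C.TagVertex) : C.point ε v ∈ T \ C.cx.space := by
  obtain ⟨δ, σ⟩ := v
  obtain ⟨r, hr, hj⟩ := joinedIn_point_of_near hC hε δ σ (centroid_mem_openCell δ)
  have hσ : ((σ : ℤ) : ℝ) * ((σ : ℤ) : ℝ) = 1 := by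
    rcases Int.units_eq_one_or σ with rfl | rfl <;> simp
  have hσ' : |((σ : ℤ) : ℝ)| = 1 := by
    rcases Int.units_eq_one_or σ with rfl | rfl <;> simp
  refine (hj (C.centroid δ + (((σ : ℤ) : ℝ) * (r / 2)) • C.unitNormal δ) ?_ ?_).target_mem
  · rw [mem_ball_iff_norm, add_sub_cancel_left, norm_smul, norm_unitNormal, Real.norm_eq_abs,
      abs_mul, hσ', abs_of_pos (half_pos hr)]
    linarith
  · rw [add_sub_cancel_left, inner_smul_right, inner_unitNormal_self, mul_one, ← mul_assoc, hσ]
    linarith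

end OrientedTwoComplex

theorem mainTheorem6 (T : Affine.Simplex ℝ E3 3) (C : OrientedTwoComplex)
    (hC : C.cx.space ⊆ interior (convexHull ℝ (Set.range T.points)))
    (ε : C.Triangle → ℝ) (hε : C.AdmissibleOffset (convexHull ℝ (Set.range T.points)) ε)
    (v w : C.TagVertex) (hvw : C.tag.Reachable v w) :
    JoinedIn (convexHull ℝ (Set.range T.points) \ C.cx.space) (C.point ε v) (C.point ε w) := by
  rw [SimpleGraph.reachable_iff_reflTransGen] at hvw
  induction hvw with
  | refl => exact JoinedIn.refl (OrientedTwoComplex.point_mem hC hε v)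
  | tail _ hadj ih =>
    refine ih.trans ?_
    rcases (SimpleGraph.fromRel_adj _ _ _).mp hadj with
      ⟨-, ⟨e, δ₁, δ₂, hn, rfl, rfl⟩ | ⟨e, δ₁, δ₂, hn, rfl, rfl⟩⟩
    · exact OrientedTwoComplex.joinedIn_point_of_nextAround hC hε hn
    · exact (OrientedTwoComplex.joinedIn_point_of_nextAround hC hε hn).symm
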